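/- **Model.** A ring of $n\ge 1$ nodes is a cycle on $n$ nodes (for $n=2$ with a double edge, for $n=1$ a loop); each node is attached to its two incident edge ends by ports, called Port 0 and Port 1, assigned arbitrarily and independently of any direction of the ring. The ring is anonymous: all nodes are identical, have no IDs, do not know $n$ or any bound on it, and run the same algorithm; each node has its own, independent infinite sequence of fair coin flips. Messages have no content (pulses). A node acts once at the beginning and afterwards only upon receiving a pulse; as a function of its coin flips (almost surely, finitely many of them for each action) and of the sequence of ports at which it has received pulses so far, it may send any finite number of pulses through each port, and it updates its output: a decision Leader or Non-Leader (or none yet), and a label "clockwise" on one of its ports (or none yet); it may also enter a terminating state, after which it ignores all pulses. The network is asynchronous: pulses are neither lost nor created, and as long as pulses are in transit, an arbitrary one of them is delivered next; a rule for choosing it is a schedule. The network is quiescent when no pulse is in transit. The clockwise labels orient the ring if, starting from any node and moving repeatedly through the port labelled clockwise, one passes through all edges. **Theorem.** For every real $c>0$ there are such a randomized content-oblivious algorithm (not depending on $n$) and constants $C$ and $k$ such that for every $n\ge 1$ and every assignment of ports in the anonymous ring of $n$ nodes: 1. with probability at least $1-C\,n^{-c}$ over the coin flips, the following holds under every schedule: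 the network reaches quiescence after at most $C\,n^{k}$ pulses have been sent in total, and then exactly one node has output Leader, all other nodes have output Non-Leader, and the clockwise labels of the nodes orient the ring; 2. with probability $1$, the network reaches quiescence under every schedule; 3. the algorithm does not terminate: no node ever enters a terminating state. -/

import Mathlib

open MeasureTheory

namespace ContentOblivious

noncomputable section

/-- The two ports of a node: `false` is Port 0 and `true` is Port 1. -/
abbrev Port := Bool

/-! ### Randomness -/

/-- The private random source of one node: an infinite sequence of coin flips. -/
abbrev Tape := ℕ → Bool

/-- The law of one fair coin flip. -/
def fairCoin : Measure Bool := (PMF.uniformOfFintype Bool).toMeasure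

instance : IsProbabilityMeasure fairCoin := by
  unfold fairCoin; infer_instance

/-- The law of a tape: independent fair coin flips. -/
def tapeLaw : Measure Tape := Measure.infinitePi (fun _ : ℕ => fairCoin)

instance : IsProbabilityMeasure tapeLaw := by
  unfold tapeLaw; infer_instance

/-- The joint law of the tapes of the `n` nodes: independent tapes. -/
def ringLaw (n : ℕ) [NeZero n] : Measure (ZMod n → Tape) :=
  Measure.pi (fun _ : ZMod n => tapeLaw)

/-! ### Content-oblivious algorithms for identical nodes -/

/-- The possible decisions of a node in leader election. -/
inductive Role
  | leader
  | nonLeader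

/-- What a node does when it is activated: the number of pulses it sends through each port, and
its state afterwards as far as it is visible: its current decision (if any), the port it currently
labels as clockwise (if any), and whether it has entered a terminating state. -/
structure Action where
  send : Port → ℕ
  role : Option Role
  cwPort : Option Port
  terminated : Bool

/-- A randomized, uniform, event-driven content-oblivious algorithm, run by every node of an
anonymous network. `act ω h` is the action of a node with tape `ω` at the moment when the
sequence of ports at which it has received pulses so far is `h`, latest first; `act ω []` is its
action at the very beginning. Nothing else (an ID, the number of nodes, a message content, the
time) is available to the node. Every action uses, almost surely, finitely many coin flips. -/
structure Algorithm where
  act : Tape → List Port → Action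
  finitely_many_coins : ∀ h : List Port, ∀ᵐ ω ∂tapeLaw,
    ∃ k : ℕ, ∀ ω' : Tape, (∀ i < k, ω' i = ω i) → act ω' h = act ω h

/-! ### Rings

The nodes of a ring of size `n` are the elements of `ZMod n`, and `v` is joined to `v + 1` by an
edge (two nodes are joined by two parallel edges, a single node has a loop). The assignment of
ports is arbitrary: `o v` is the port of `v` on the edge from `v` to `v + 1`, and `!o v` is its
port on the edge from `v - 1` to `v`. -/

/-- The other end of the edge that is attached to port `x.2` of node `x.1`. -/
def link {n : ℕ} (o : ZMod n → Port) (x : ZMod n × Port) : ZMod n × Port :=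
  if x.2 = o x.1 then (x.1 + 1, !o (x.1 + 1)) else (x.1 - 1, o (x.1 - 1))

/-- The labelling `cw` of one port of each node as clockwise is a consistent orientation:
from every node, moving repeatedly through the port labelled clockwise passes through all edges
of the ring. An edge is represented by any of its two ends `x` and `link o x`. -/
def IsOrientation {n : ℕ} (o : ZMod n → Port) (cw : ZMod n → Port) : Prop :=
  ∀ (s : ZMod n) (x : ZMod n × Port), ∃ k : ℕ,
    let v := (fun u => (link o (u, cw u)).1)^[k] s
    x = (v, cw v) ∨ x = link o (v, cw v)

/-! ### Asynchronous executions -/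

/-- A configuration: the pulses that each node has processed so far, the number of pulses in
transit towards each port of each node, and the total number of pulses sent so far. -/
structure Config (n : ℕ) where
  hist : ZMod n → List Port
  transit : ZMod n × Port → ℕ
  sent : ℕ

/-- No pulse is in transit. -/
def Config.Quiescent {n : ℕ} (s : Config n) : Prop := ∀ x, s.transit x = 0

namespace Algorithm

variable {n : ℕ} [NeZero n]

/-- The latest action of node `v` in the configuration `s`. -/
def current (A : Algorithm) (ω : ZMod n → Tape) (s : Config n) (v : ZMod n) : Action :=
  A.act (ω v) (s.hist v)

/-- The configuration after every node has acted once at the beginning. -/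
def start (A : Algorithm) (o : ZMod n → Port) (ω : ZMod n → Tape) : Config n where
  hist := fun _ => []
  transit := fun x => (A.act (ω (link o x).1) []).send (link o x).2
  sent := ∑ v, ∑ q, (A.act (ω v) []).send q

/-- One pulse in transit towards port `p` of node `v` is delivered and `v` reacts to it.
A node in a terminating state ignores the pulse. -/
def deliver (A : Algorithm) (o : ZMod n → Port) (ω : ZMod n → Tape) (s : Config n)
    (v : ZMod n) (p : Port) : Config n :=
  let rest : ZMod n × Port → ℕ := Function.update s.transit (v, p) (s.transit (v, p) - 1)
  if (A.current ω s v).terminated then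
    { s with transit := rest }
  else
    let a := A.act (ω v) (p :: s.hist v)
    { hist := Function.update s.hist v (p :: s.hist v)
      transit := fun x => rest x + if (link o x).1 = v then a.send (link o x).2 else 0
      sent := s.sent + ∑ q, a.send q }

/-- `e` is a (maximal) execution: as long as some pulse is in transit, one such pulse,
chosen arbitrarily by the asynchronous network, is delivered next. -/
def IsExecution (A : Algorithm) (o : ZMod n → Port) (ω : ZMod n → Tape) (e : ℕ → Config n) :
    Prop :=
  e 0 = A.start o ω ∧
  ∀ t, (∃ v p, 0 < (e t).transit (v, p) ∧ e (t + 1) = A.deliver o ω (e t) v p) ∨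
    ((e t).Quiescent ∧ e (t + 1) = e t)

/-- Exactly one node has decided to be the leader, and all the others not to be. -/
def ElectsLeader (A : Algorithm) (ω : ZMod n → Tape) (s : Config n) : Prop :=
  ∃ l : ZMod n, (A.current ω s l).role = some Role.leader ∧
    ∀ v, v ≠ l → (A.current ω s v).role = some Role.nonLeader

/-- Every node labels one of its ports as clockwise, and this orients the ring. -/
def OrientsRing (A : Algorithm) (o : ZMod n → Port) (ω : ZMod n → Tape) (s : Config n) : Prop :=
  ∃ cw : ZMod n → Port, (∀ v, (A.current ω s v).cwPort = some (cw v)) ∧ IsOrientation o cw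

/-- In the execution `e` the network reaches quiescence after at most `B` pulses have been sent
in total, with a leader elected and the ring oriented. (A quiescent configuration does not change
any more, so these are the final outputs and the total number of pulses.) -/
def Succeeds (A : Algorithm) (o : ZMod n → Port) (ω : ZMod n → Tape) (e : ℕ → Config n)
    (B : ℝ) : Prop :=
  ∃ t, (e t).Quiescent ∧ ((e t).sent : ℝ) ≤ B ∧ A.ElectsLeader ω (e t) ∧ A.OrientsRing o ω (e t)

end Algorithm

end

end ContentOblivious

namespace ContentOblivious

noncomputable section

set_option linter.unusedSectionVars false

/-! Give each node a positive number `i` and the two identifiers `2 * i`, `2 * i + 1`, one per port.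
Every node starts one pulse each way and passes on all pulses it receives, absorbing only the one
whose rank at its port equals that port's identifier. The two directions do not interact. In one
direction, a node has sent one pulse more than it has received until it absorbs, and equally many
afterwards. Hence no count exceeds the largest identifier (`received_le`), so every execution stops.
At rest, summing around the cycle forces all counts to be equal, every node has absorbed, and the
common count is the largest identifier (`eq_max_of_forwarded_pred`). If the largest `i` is held by
one node `l`, the two counts are `2 * i l` and `2 * i l + 1` everywhere. Their parity gap orients
the ring, and only `l` recognises the larger one as its own (`succeeds_of_unique_max`). The `i` are
random, of bit length proportional to a geometric variable. With high probability some node exceeds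
a suitable power of `n`, no two nodes share a value that large, and all values are polynomial
(`ringLaw_not_unique_max_le`, `failure_bound`). -/

/-! ### The pulse-counting algorithm with given identifiers -/

/-- The identifier of a node for the pulses that arrive at port `p`. -/
def portId (i : ℕ) (p : Port) : ℕ := 2 * i + p.toNat

/-- The number of pulses a node with identifier `i` has sent onwards (its initial pulse included)
after it has received `r` pulses from one direction: the `i`-th one is absorbed. -/
def forwarded (i r : ℕ) : ℕ := if r < i then r + 1 else r

/-- The action of a node with identifier `i` after the sequence `h` of received pulses. -/
def countingAct (i : ℕ) (h : List Port) : Action where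
  send q := match h with
    | [] => 1
    | p :: _ => if q = !p ∧ h.count p ≠ portId i p then 1 else 0
  role := if max (h.count false) (h.count true) = portId i true then some Role.leader
    else some Role.nonLeader
  cwPort := some (decide (h.count true < h.count false))
  terminated := false

lemma portId_pos {i : ℕ} (hi : 0 < i) (p : Port) : 0 < portId i p := by
  unfold portId; omega

lemma forwarded_zero {i : ℕ} (hi : 0 < i) : forwarded i 0 = 1 := by
  simp [forwarded, hi]

lemma forwarded_succ (i r : ℕ) :
    forwarded i (r + 1) = forwarded i r + if r + 1 ≠ i then 1 else 0 := by
  unfold forwarded; split_ifs <;> omega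

lemma le_forwarded (i r : ℕ) : r ≤ forwarded i r := by
  unfold forwarded; split_ifs <;> omega

/-- The extra pulse is ahead only while `r < i`, so it cannot push the count past `m`. -/
lemma forwarded_le {i r m : ℕ} (hi : i ≤ m) (hr : r ≤ m) : forwarded i r ≤ m := by
  unfold forwarded; split_ifs <;> omega

lemma le_of_forwarded_eq {i r : ℕ} (h : forwarded i r = r) : i ≤ r := by
  unfold forwarded at h; split_ifs at h <;> omega

/-- The number of pulses sent through port `q` after the sequence `h` of received pulses. -/
def sentThrough (i : ℕ) (h : List Port) (q : Port) : ℕ :=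
  forwarded (portId i (!q)) (h.count (!q))

lemma sentThrough_cons (i : ℕ) (h : List Port) (p q : Port) :
    sentThrough i (p :: h) q = sentThrough i h q + (countingAct i (p :: h)).send q := by
  unfold sentThrough countingAct
  by_cases hq : q = !p
  · subst hq
    simp [forwarded_succ]
  · have : q = p := by revert hq; cases p <;> cases q <;> simp
    subst this
    have : (q == !q) = false := by cases q <;> rfl
    cases q <;> simp

/-- The history of each node accounts for all pulses sent and in transit. -/
structure Balanced {n : ℕ} [NeZero n] (o : ZMod n → Port) (i : ZMod n → ℕ) (s : Config n) :
    Prop where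
  transit_add_count : ∀ x : ZMod n × Port, s.transit x + (s.hist x.1).count x.2 =
    sentThrough (i (link o x).1) (s.hist (link o x).1) (link o x).2
  sent_eq : s.sent = ∑ v, ∑ q, sentThrough (i v) (s.hist v) q

section Execution

variable {n : ℕ} [NeZero n] {A : Algorithm} {o : ZMod n → Port} {ω : ZMod n → Tape}
  {i : ZMod n → ℕ}

lemma balanced_start (hA : ∀ v h, A.act (ω v) h = countingAct (i v) h) (hi : ∀ v, 0 < i v) :
    Balanced o i (A.start o ω) := by
  constructor
  · intro x
    simp [Algorithm.start, hA, sentThrough, forwarded_zero (portId_pos (hi _) _), countingAct]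
  · simp [Algorithm.start, hA, sentThrough, forwarded_zero (portId_pos (hi _) _), countingAct]

lemma deliver_eq (hA : ∀ v h, A.act (ω v) h = countingAct (i v) h) (s : Config n) (v : ZMod n)
    (p : Port) : A.deliver o ω s v p =
      { hist := Function.update s.hist v (p :: s.hist v)
        transit := fun x => Function.update s.transit (v, p) (s.transit (v, p) - 1) x +
          if (link o x).1 = v then (countingAct (i v) (p :: s.hist v)).send (link o x).2 else 0
        sent := s.sent + ∑ q, (countingAct (i v) (p :: s.hist v)).send q } := by
  have : (A.current ω s v).terminated = false := by simp [Algorithm.current, hA, countingAct]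
  simp [Algorithm.deliver, this, hA]

lemma sentThrough_update (h : ZMod n → List Port) (v u : ZMod n) (p q : Port) :
    sentThrough (i u) (Function.update h v (p :: h v) u) q = sentThrough (i u) (h u) q +
      if u = v then (countingAct (i v) (p :: h v)).send q else 0 := by
  by_cases hu : u = v
  · subst hu; simp [sentThrough_cons]
  · simp [hu]

lemma Balanced.deliver (hA : ∀ v h, A.act (ω v) h = countingAct (i v) h) {s : Config n}
    (hs : Balanced o i s) {v : ZMod n} {p : Port} (hp : 0 < s.transit (v, p)) :
    Balanced o i (A.deliver o ω s v p) := by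
  rw [deliver_eq hA]
  constructor
  · intro x
    -- Delivery moves one pulse from transit into the history, so only the newly sent pulses change
    -- the balance.
    have key : Function.update s.transit (v, p) (s.transit (v, p) - 1) x +
        (Function.update s.hist v (p :: s.hist v) x.1).count x.2 =
        s.transit x + (s.hist x.1).count x.2 := by
      obtain ⟨u, q⟩ := x
      by_cases hu : u = v
      · subst hu
        by_cases hq : q = p
        · subst hq
          simp
          omega
        · have : ¬ p = q := fun h => hq h.symm
          simp [hq, this]
      · simp [hu]
    have := hs.transit_add_count x
    simp only [sentThrough_update]
    omega
  · simp only [sentThrough_update, Finset.sum_add_distrib, hs.sent_eq]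
    congr 1
    rw [Finset.sum_comm]
    simp

lemma Balanced.of_isExecution (hA : ∀ v h, A.act (ω v) h = countingAct (i v) h)
    (hi : ∀ v, 0 < i v) {e : ℕ → Config n} (he : A.IsExecution o ω e) (t : ℕ) :
    Balanced o i (e t) := by
  induction t with
  | zero => rw [he.1]; exact balanced_start hA hi
  | succ t ih =>
    rcases he.2 t with ⟨v, p, hp, h⟩ | ⟨_, h⟩
    · rw [h]; exact ih.deliver hA hp
    · rw [h]; exact ih

end Execution

/-! ### Pulses moving in one direction -/

section Direction

variable {n : ℕ} [NeZero n] (o : ZMod n → Port)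

/-- The port at which node `v` receives the pulses that move in direction `b`, where `true` is
the direction from `v` to `v + 1`. -/
def inPort (b : Bool) (v : ZMod n) : Port := xor b (o v)

/-- The node from which node `v` receives the pulses that move in direction `b`. -/
def pred (b : Bool) (v : ZMod n) : ZMod n := if b then v - 1 else v + 1

lemma link_inPort (b : Bool) (v : ZMod n) :
    link o (v, inPort o b v) = (pred b v, !inPort o b (pred b v)) := by
  cases b <;> simp [link, inPort, pred]

lemma exists_inPort (v : ZMod n) (p : Port) : ∃ b, p = inPort o b v :=
  ⟨xor p (o v), by simp [inPort]⟩

lemma sum_pred (b : Bool) (f : ZMod n → ℕ) : ∑ v, f (pred b v) = ∑ v, f v := by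
  cases b
  · exact Equiv.sum_comp (Equiv.addRight (1 : ZMod n)) f
  · exact Equiv.sum_comp (Equiv.subRight (1 : ZMod n)) f

lemma eq_of_pred_eq {b : Bool} {f : ZMod n → ℕ} (h : ∀ v, f (pred b v) = f v) (u v : ZMod n) :
    f u = f v := by
  have step : ∀ w, f (w + 1) = f w := by
    intro w
    cases b
    · exact h w
    · simpa [pred] using (h (w + 1)).symm
  have all : ∀ k : ℕ, f k = f 0 := by
    intro k
    induction k with
    | zero => simp
    | succ k ih => rw [Nat.cast_succ, step, ih]
  rw [← ZMod.natCast_zmod_val u, ← ZMod.natCast_zmod_val v, all, all]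

/-- At quiescence every node has received as many pulses as the largest identifier. -/
lemma eq_max_of_forwarded_pred {b : Bool} {f j : ZMod n → ℕ} {m : ℕ}
    (hf : ∀ v, f v = forwarded (j (pred b v)) (f (pred b v))) (hm : ∀ v, f v ≤ m)
    (hj : ∃ v, j v = m) (v : ZMod n) : f v = m := by
  have hle : ∀ v, f (pred b v) ≤ f v := fun v => by
    rw [hf v]; exact le_forwarded _ _
  -- Counts that never decrease around a cycle are constant, since both sides have the same sum.
  have heq : ∀ v, f (pred b v) = f v := by
    have := (Finset.sum_eq_sum_iff_of_le (fun v _ => hle v)).1 (sum_pred b f)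
    exact fun v => this v (Finset.mem_univ v)
  have hid : ∀ v, j v ≤ f v := by
    intro v
    obtain ⟨w, rfl⟩ : ∃ w, pred b w = v := by
      cases b
      · exact ⟨v - 1, by simp [pred]⟩
      · exact ⟨v + 1, by simp [pred]⟩
    exact le_of_forwarded_eq ((hf w).symm.trans (heq w).symm)
  obtain ⟨u, hu⟩ := hj
  rw [eq_of_pred_eq heq v u]
  exact le_antisymm (hm u) (hu ▸ hid u)

/-- The number of pulses moving in direction `b` that node `v` has received. -/
def received (s : Config n) (b : Bool) (v : ZMod n) : ℕ := (s.hist v).count (inPort o b v)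

/-- The identifier of node `v` for pulses moving in direction `b`. -/
def dirId (i : ZMod n → ℕ) (b : Bool) (v : ZMod n) : ℕ := portId (i v) (inPort o b v)

variable {o} {i : ZMod n → ℕ}

/-- Pulses leave opposite to where they enter and so keep their direction: each direction obeys a
recurrence of its own, whatever the port assignment. -/
lemma Balanced.transit_add_received {s : Config n} (hs : Balanced o i s) (b : Bool) (v : ZMod n) :
    s.transit (v, inPort o b v) + received o s b v =
      forwarded (dirId o i b (pred b v)) (received o s b (pred b v)) := by
  have := hs.transit_add_count (v, inPort o b v)
  simpa [link_inPort, sentThrough, received, dirId] using this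

lemma Balanced.sent_le {s : Config n} (hs : Balanced o i s) {m : ℕ}
    (hi : ∀ b v, dirId o i b v ≤ m) (hr : ∀ b v, received o s b v ≤ m) :
    s.sent ≤ n * (2 * m) := by
  rw [hs.sent_eq]
  have : ∀ v q, sentThrough (i v) (s.hist v) q ≤ m := by
    intro v q
    obtain ⟨b, hb⟩ := exists_inPort o v (!q)
    unfold sentThrough
    rw [hb]
    exact forwarded_le (hi b v) (hr b v)
  calc ∑ v, ∑ q, sentThrough (i v) (s.hist v) q ≤ ∑ v : ZMod n, ∑ q : Port, m :=
        Finset.sum_le_sum fun v _ => Finset.sum_le_sum fun q _ => this v q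
    _ = n * (2 * m) := by simp [ZMod.card]

end Direction

/-! ### Bounds, quiescence and outcome of executions -/

section Execution

variable {n : ℕ} [NeZero n] {A : Algorithm} {o : ZMod n → Port} {ω : ZMod n → Tape}
  {i : ZMod n → ℕ}

lemma start_hist (v : ZMod n) : (A.start o ω).hist v = [] := rfl

/-- A delivered pulse was counted among those sent by the predecessor, and these are at most `m` by
induction over time. -/
lemma received_le (hA : ∀ v h, A.act (ω v) h = countingAct (i v) h)
    (hi : ∀ v, 0 < i v) {e : ℕ → Config n} (he : A.IsExecution o ω e) {b : Bool} {m : ℕ}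
    (hm : ∀ v, dirId o i b v ≤ m) (t : ℕ) (v : ZMod n) : received o (e t) b v ≤ m := by
  induction t generalizing v with
  | zero => simp [he.1, received, start_hist]
  | succ t ih =>
    have hb := (Balanced.of_isExecution hA hi he t).transit_add_received b
    rcases he.2 t with ⟨u, p, hp, h⟩ | ⟨_, h⟩
    · by_cases hv : v = u ∧ p = inPort o b v
      · obtain ⟨rfl, rfl⟩ := hv
        have h1 := forwarded_le (hm (pred b v)) (ih (pred b v))
        have h2 := hb v
        have h3 : received o (e (t + 1)) b v = received o (e t) b v + 1 := by
          rw [h, deliver_eq hA]; simp [received]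
        omega
      · have h3 : received o (e (t + 1)) b v = received o (e t) b v := by
          rw [h, deliver_eq hA]
          by_cases hu : v = u
          · subst hu
            have : ¬ p = inPort o b v := fun h => hv ⟨rfl, h⟩
            simp [received, this]
          · simp [received, hu]
        rw [h3]; exact ih v
    · rw [h]; exact ih v

lemma length_eq (s : Config n) (v : ZMod n) :
    (s.hist v).length = received o s true v + received o s false v := by
  unfold received inPort
  cases o v <;> simp

/-- Without quiescence each step lengthens some history, yet histories are bounded. Uniqueness of
the maximum plays no role, so this covers every outcome of the coins. -/
lemma exists_quiescent (hA : ∀ v h, A.act (ω v) h = countingAct (i v) h)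
    (hi : ∀ v, 0 < i v) {e : ℕ → Config n} (he : A.IsExecution o ω e) :
    ∃ t, (e t).Quiescent := by
  by_contra! hq
  have hlen : ∀ t, ∑ v, ((e t).hist v).length = t := by
    intro t
    induction t with
    | zero => simp [he.1, start_hist]
    | succ t ih =>
      rcases he.2 t with ⟨u, p, hp, h⟩ | ⟨h, _⟩
      · rw [h, deliver_eq hA]
        have : ∀ v, (Function.update (e t).hist u (p :: (e t).hist u) v).length =
            ((e t).hist v).length + if v = u then 1 else 0 := by
          intro v
          by_cases hv : v = u
          · subst hv; simp
          · simp [hv]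
        simp [this, Finset.sum_add_distrib, ih]
      · exact absurd h (hq t)
  let m := ∑ v, (2 * i v + 1)
  have hm : ∀ b v, dirId o i b v ≤ m := by
    intro b v
    refine le_trans ?_ (Finset.single_le_sum (f := fun v => 2 * i v + 1)
      (fun _ _ => Nat.zero_le _) (Finset.mem_univ v))
    have := Bool.toNat_le (inPort o b v)
    simp only [dirId, portId]; omega
  have hle : ∀ t, t ≤ n * (m + m) := by
    intro t
    calc t = ∑ v, ((e t).hist v).length := (hlen t).symm
      _ ≤ ∑ v : ZMod n, (m + m) := Finset.sum_le_sum fun v _ => by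
          rw [length_eq (o := o)]
          exact add_le_add (received_le hA hi he (hm true) t v)
            (received_le hA hi he (hm false) t v)
      _ = n * (m + m) := by simp [ZMod.card]
  exact absurd (hle (n * (m + m) + 1)) (by omega)

/-- Sending everything out of the ports opposite to the ones where the pulses of direction `b`
arrive orients the ring. -/
lemma isOrientation_not_inPort (b : Bool) :
    IsOrientation o (fun v => !inPort o b v) := by
  -- Following the labels means moving along direction `b`, a translation by `1` or `-1` of `ZMod
  -- n`, which reaches every node.
  have hstep : (fun u => (link o (u, !inPort o b u)).1) = pred (n := n) (!b) := by
    funext u; cases b <;> simp [link, inPort, pred]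
  have hlink : ∀ v, link o (pred b v, !inPort o b (pred b v)) = (v, inPort o b v) := by
    intro v; cases b <;> simp [link, inPort, pred]
  have hreach : ∀ s v : ZMod n, ∃ k : ℕ, (pred (n := n) (!b))^[k] s = v := by
    intro s v
    cases b
    · refine ⟨(s - v).val, ?_⟩
      have : ∀ k : ℕ, (pred (n := n) true)^[k] s = s - k := by
        intro k
        induction k with
        | zero => simp
        | succ k ih => rw [Function.iterate_succ_apply', ih]; simp [pred]; ring
      simp [this]
    · refine ⟨(v - s).val, ?_⟩
      have : ∀ k : ℕ, (pred (n := n) false)^[k] s = s + k := by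
        intro k
        induction k with
        | zero => simp
        | succ k ih => rw [Function.iterate_succ_apply', ih]; simp [pred]; ring
      simp [this]
  rintro s ⟨w, p⟩
  simp only [hstep]
  by_cases hp : p = inPort o b w
  · obtain ⟨k, hk⟩ := hreach s (pred b w)
    exact ⟨k, Or.inr (by rw [hk, hlink, hp])⟩
  · obtain ⟨k, hk⟩ := hreach s w
    refine ⟨k, Or.inl ?_⟩
    rw [hk, Bool.eq_not_of_ne hp]

/-- If the largest identifier is attained once and is at most `B`, the algorithm succeeds. -/
lemma succeeds_of_unique_max (hA : ∀ v h, A.act (ω v) h = countingAct (i v) h)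
    (hi : ∀ v, 0 < i v) {e : ℕ → Config n} (he : A.IsExecution o ω e) {l : ZMod n}
    (hl : ∀ v, v ≠ l → i v < i l) {B : ℝ} (hB : (n * (2 * (2 * i l + 1)) : ℕ) ≤ B) :
    A.Succeeds o ω e B := by
  obtain ⟨t, ht⟩ := exists_quiescent hA hi he
  -- From `i v < i l` follows `2 * i v + 1 < 2 * i l`, so `l` is maximal in both directions
  -- regardless of the port bits.
  have hmax : ∀ b v, dirId o i b v ≤ dirId o i b l := by
    intro b v
    by_cases hv : v = l
    · rw [hv]
    · have h1 := hl v hv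
      have h2 := Bool.toNat_le (inPort o b v)
      simp only [dirId, portId]; omega
  have hrec : ∀ b v, received o (e t) b v = dirId o i b l := by
    intro b v
    refine eq_max_of_forwarded_pred (b := b) (j := dirId o i b) (fun v => ?_)
      (received_le hA hi he (hmax b) t) ⟨l, rfl⟩ v
    have := (Balanced.of_isExecution hA hi he t).transit_add_received b v
    rwa [ht, zero_add] at this
  -- the direction in which the larger of the two identifiers of `l` wins
  obtain ⟨b, hb⟩ := exists_inPort o l true
  have hnb : inPort o (!b) l = false := by
    unfold inPort at hb ⊢; revert hb; cases b <;> cases o l <;> simp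
  have hcount : ∀ v, ((e t).hist v).count (inPort o b v) = 2 * i l + 1 := by
    intro v; have := hrec b v; simpa [received, dirId, ← hb, portId] using this
  have hcount' : ∀ v, ((e t).hist v).count (!inPort o b v) = 2 * i l := by
    intro v; have := hrec (!b) v
    have h : inPort o (!b) v = !inPort o b v := by unfold inPort; cases b <;> simp
    simpa [received, dirId, hnb, portId, h] using this
  -- The port that received fewer pulses is labelled clockwise; it is the one through which the
  -- pulses of the larger count leave.
  have hcounts : ∀ v, max (((e t).hist v).count false) (((e t).hist v).count true) = 2 * i l + 1 ∧
      decide (((e t).hist v).count true < ((e t).hist v).count false) = !inPort o b v := by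
    intro v
    have h1 := hcount v
    have h2 := hcount' v
    cases hv : inPort o b v <;> simp only [hv, Bool.not_true, Bool.not_false] at h1 h2 <;>
      simp [h1, h2]
  have hdir : ∀ b v, dirId o i b v ≤ 2 * i l + 1 := by
    intro b v
    refine (hmax b v).trans ?_
    have := Bool.toNat_le (inPort o b l)
    simp only [dirId, portId]; omega
  refine ⟨t, ht, ?_, ⟨l, ?_, fun v hv => ?_⟩, fun v => !inPort o b v, fun v => ?_,
    isOrientation_not_inPort b⟩
  · refine le_trans (Nat.cast_le.2 ?_) hB
    exact (Balanced.of_isExecution hA hi he t).sent_le hdir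
      (fun b v => (hrec b v).trans_le (hdir b l))
  · simp [Algorithm.current, hA, countingAct, (hcounts l).1, portId]
  · have := hl v hv
    have h : ¬ (i l = i v) := by omega
    simp [Algorithm.current, hA, countingAct, (hcounts v).1, portId, h]
  · simp only [Algorithm.current, hA, countingAct, (hcounts v).2]

end Execution

/-! ### Random identifiers -/

/-- The second alternative makes the search for a head total; on the all-tails tape it returns `0`.
-/
lemma exists_head_or_all_tails (ω : Tape) : ∃ j, ω j = true ∨ ∀ i, ω i = false := by
  by_cases h : ∃ j, ω j = true
  · exact h.imp fun _ => Or.inl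
  · exact ⟨0, Or.inr fun i => by simpa using fun hi => h ⟨i, hi⟩⟩

open scoped Classical in
/-- The index of the first head of a tape (`0` if there is none). -/
def firstHead (ω : Tape) : ℕ := Nat.find (exists_head_or_all_tails ω)

/-- The number whose binary digits are the first `l` coin flips, preceded by a digit `1`. -/
def prefixCode (l : ℕ) (ω : Tape) : ℕ := 2 ^ l + Nat.ofBits (fun j : Fin l => ω j)

/-- The random identifier of a node: the length of the prefix of the tape that it encodes is `K`
times the (geometrically distributed) number of coin flips until the first head. -/
def randomId (K : ℕ) (ω : Tape) : ℕ := prefixCode (K * (firstHead ω + 1)) ω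

lemma two_pow_le_prefixCode (l : ℕ) (ω : Tape) : 2 ^ l ≤ prefixCode l ω := Nat.le_add_right _ _

lemma prefixCode_lt (l : ℕ) (ω : Tape) : prefixCode l ω < 2 ^ (l + 1) := by
  have := Nat.ofBits_lt_two_pow (fun j : Fin l => ω j)
  unfold prefixCode; omega

/-- The leading digit `1` makes the length of the prefix recoverable from its code. -/
lemma log_prefixCode (l : ℕ) (ω : Tape) : Nat.log 2 (prefixCode l ω) = l :=
  (Nat.log_eq_iff (Or.inr ⟨one_lt_two, (lt_of_lt_of_le (by positivity) (two_pow_le_prefixCode l ω)).ne'⟩)).2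
    ⟨two_pow_le_prefixCode l ω, prefixCode_lt l ω⟩

lemma testBit_prefixCode {l j : ℕ} (hj : j < l) (ω : Tape) :
    (prefixCode l ω).testBit j = ω j := by
  rw [prefixCode, Nat.testBit_two_pow_add_gt hj, Nat.testBit_ofBits_lt _ _ hj]

lemma prefixCode_congr {l : ℕ} {ω ω' : Tape} (h : ∀ j < l, ω' j = ω j) :
    prefixCode l ω' = prefixCode l ω := by
  unfold prefixCode
  congr 2
  funext j
  exact h j j.2

lemma randomId_pos (K : ℕ) (ω : Tape) : 0 < randomId K ω :=
  lt_of_lt_of_le (by positivity) (two_pow_le_prefixCode _ _)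

lemma firstHead_eq_iff {ω : Tape} (h : ∃ j, ω j = true) (m : ℕ) :
    firstHead ω = m ↔ ω m = true ∧ ∀ j < m, ω j = false := by
  classical
  have h' : ¬ ∀ i, ω i = false := by simpa using h
  unfold firstHead
  rw [Nat.find_eq_iff]
  simp [h']

lemma eq_false_of_lt_firstHead {ω : Tape} {j : ℕ} (hj : j < firstHead ω) : ω j = false := by
  classical
  have := Nat.find_min (exists_head_or_all_tails ω) hj
  simpa using (not_or.1 this).1

lemma measurableSet_coin (j : ℕ) (b : Bool) : MeasurableSet {ω : Tape | ω j = b} :=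
  (measurable_pi_apply (X := fun _ : ℕ => Bool) j) (measurableSet_singleton b)

lemma measurable_firstHead : Measurable firstHead := by
  classical
  unfold firstHead
  refine measurable_find _ fun k => ?_
  have : {ω : Tape | ω k = true ∨ ∀ i, ω i = false} =
      {ω | ω k = true} ∪ ⋂ i, {ω | ω i = false} := by ext; simp
  rw [this]
  exact (measurableSet_coin _ _).union (MeasurableSet.iInter fun i => measurableSet_coin _ _)

lemma measurable_prefixCode (l : ℕ) : Measurable (prefixCode l) := by
  have h1 : Measurable (fun (ω : Tape) (j : Fin l) => ω j) :=
    measurable_pi_lambda _ fun j => measurable_pi_apply _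
  exact (measurable_of_countable (fun f : Fin l → Bool => 2 ^ l + Nat.ofBits f)).comp h1

lemma measurable_randomId (K : ℕ) : Measurable (randomId K) := by
  have h : Measurable (fun x : ℕ × Tape => prefixCode (K * (x.1 + 1)) x.2) :=
    measurable_from_prod_countable_right fun g => measurable_prefixCode (K * (g + 1))
  exact h.comp (measurable_firstHead.prodMk measurable_id)

lemma fairCoin_singleton (b : Bool) : fairCoin {b} = 2⁻¹ := by
  rw [fairCoin, PMF.toMeasure_apply_singleton _ _ (measurableSet_singleton b)]
  simp [PMF.uniformOfFintype_apply]

/-- The law of the first `l` coin flips is uniform. -/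
lemma tapeLaw_initial_flips (l : ℕ) (f : ℕ → Bool) :
    tapeLaw {ω | ∀ j < l, ω j = f j} = (2⁻¹ : ENNReal) ^ l := by
  have : {ω : Tape | ∀ j < l, ω j = f j} = Set.pi (Finset.range l : Set ℕ) (fun j => {f j}) := by
    ext ω; simp [Set.mem_pi]
  rw [this, tapeLaw, Measure.infinitePi_pi _ (fun _ _ => measurableSet_singleton _)]
  simp [fairCoin_singleton]

lemma ae_exists_head : ∀ᵐ ω ∂tapeLaw, ∃ j, ω j = true := by
  rw [ae_iff]
  refine le_antisymm ?_ zero_le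
  have h : ∀ l : ℕ, tapeLaw {ω | ¬ ∃ j, ω j = true} ≤ (2⁻¹ : ENNReal) ^ l := by
    intro l
    rw [← tapeLaw_initial_flips l fun _ => false]
    refine measure_mono fun ω hω j _ => ?_
    simpa using fun hj => hω ⟨j, hj⟩
  exact ge_of_tendsto' (ENNReal.tendsto_pow_atTop_nhds_zero_of_lt_one (by simp)) h

lemma tapeLaw_le_firstHead (l : ℕ) : tapeLaw {ω | l ≤ firstHead ω} ≤ (2⁻¹ : ENNReal) ^ l := by
  rw [← tapeLaw_initial_flips l fun _ => false]
  exact measure_mono fun ω hω j hj => eq_false_of_lt_firstHead (hj.trans_le hω)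

lemma tapeLaw_firstHead_lt (l : ℕ) :
    tapeLaw {ω | firstHead ω < l} ≤ 1 - (2⁻¹ : ENNReal) ^ l := by
  have hm : MeasurableSet {ω : Tape | ∀ j < l, ω j = false} := by
    have : {ω : Tape | ∀ j < l, ω j = false} = ⋂ j, ⋂ (_ : j < l), {ω | ω j = false} := by
      ext; simp
    rw [this]
    exact MeasurableSet.iInter fun j => MeasurableSet.iInter fun _ =>
      measurableSet_coin j false
  rw [← tapeLaw_initial_flips l fun _ => false, ← prob_compl_eq_one_sub hm]
  refine measure_mono_ae ?_
  -- The all-tails tape has `firstHead = 0` and must be discarded as a null set.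
  filter_upwards [ae_exists_head] with ω hω hlt hall
  have h1 := ((firstHead_eq_iff hω _).1 rfl).1
  rw [hall _ hlt] at h1
  simp at h1

lemma tapeLaw_randomId_lt (K l : ℕ) :
    tapeLaw {ω | randomId K ω < 2 ^ (K * (l + 1))} ≤ 1 - (2⁻¹ : ENNReal) ^ l := by
  refine le_trans (measure_mono fun ω hω => ?_) (tapeLaw_firstHead_lt l)
  by_contra h
  have h1 : l ≤ firstHead ω := not_lt.1 h
  have h2 : 2 ^ (K * (l + 1)) ≤ randomId K ω :=
    le_trans (Nat.pow_le_pow_right two_pos (by gcongr)) (two_pow_le_prefixCode _ _)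
  exact absurd hω (not_lt.2 h2)

lemma tapeLaw_le_randomId {K : ℕ} (hK : 0 < K) (l : ℕ) :
    tapeLaw {ω | 2 ^ (K * (l + 1)) ≤ randomId K ω} ≤ (2⁻¹ : ENNReal) ^ l := by
  refine le_trans (measure_mono fun ω hω => ?_) (tapeLaw_le_firstHead l)
  by_contra h
  have h1 : firstHead ω < l := not_le.1 h
  have h2 : randomId K ω < 2 ^ (K * (l + 1)) := by
    -- The leading digit costs one more bit, which `0 < K` pays for.
    refine lt_of_lt_of_le (prefixCode_lt _ _) (Nat.pow_le_pow_right two_pos ?_)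
    calc K * (firstHead ω + 1) + 1 ≤ K * l + K := Nat.add_le_add (Nat.mul_le_mul_left K h1) hK
      _ = K * (l + 1) := by ring
  exact absurd hω (not_le.2 h2)

/-- Length and digits come from the same flips and are dependent. No independence is needed: the
value `m` alone dictates the first `l` flips. -/
lemma tapeLaw_randomId_eq_le (K : ℕ) {m l : ℕ} (hm : 2 ^ l ≤ m) :
    tapeLaw {ω | randomId K ω = m} ≤ (2⁻¹ : ENNReal) ^ l := by
  rw [← tapeLaw_initial_flips l m.testBit]
  refine measure_mono fun ω hω j hj => ?_
  have hω' : prefixCode (K * (firstHead ω + 1)) ω = m := hω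
  have hl : l ≤ K * (firstHead ω + 1) := by
    rw [← log_prefixCode (K * (firstHead ω + 1)) ω, hω']
    exact Nat.le_log_of_pow_le one_lt_two hm
  rw [← hω', testBit_prefixCode (hj.trans_le hl)]

/-- The algorithm of the theorem: every node draws an identifier and counts pulses. -/
def randomCounting (K : ℕ) (hK : 0 < K) : Algorithm where
  act ω h := countingAct (randomId K ω) h
  finitely_many_coins h := by
    filter_upwards [ae_exists_head] with ω hω
    refine ⟨K * (firstHead ω + 1), fun ω' hω' => ?_⟩
    -- As `0 < K`, the prefix contains the first head, so it determines its own length.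
    have hlt : ∀ j ≤ firstHead ω, ω' j = ω j := fun j hj => hω' j (by nlinarith)
    have h1 := (firstHead_eq_iff hω _).1 rfl
    have h2 : firstHead ω' = firstHead ω := by
      have h3 : ω' (firstHead ω) = true := (hlt _ le_rfl).trans h1.1
      exact (firstHead_eq_iff ⟨_, h3⟩ _).2 ⟨h3, fun j hj => (hlt j hj.le).trans (h1.2 j hj)⟩
    have h3 : randomId K ω' = randomId K ω := by
      unfold randomId; rw [h2]; exact prefixCode_congr hω'
    rw [h3]

/-! ### Identifiers of independent nodes -/

section Ring

variable {n : ℕ} [NeZero n]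

lemma ringLaw_coord (v : ZMod n) (S : Set Tape) :
    ringLaw n {ω | ω v ∈ S} = tapeLaw S := by
  have : {ω : ZMod n → Tape | ω v ∈ S} =
      Set.pi Set.univ (fun u => if u = v then S else Set.univ) := by
    ext ω
    simp only [Set.mem_ofPred_eq, Set.mem_pi, Set.mem_univ, true_imp_iff]
    refine ⟨fun h u => ?_, fun h => by simpa using h v⟩
    split_ifs with hu
    · rwa [hu]
    · trivial
  rw [this, ringLaw, Measure.pi_pi, Finset.prod_eq_single v] <;> simp +contextual

lemma ringLaw_coord_coord {u v : ZMod n} (huv : u ≠ v) (S T : Set Tape) :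
    ringLaw n {ω | ω u ∈ S ∧ ω v ∈ T} = tapeLaw S * tapeLaw T := by
  have : {ω : ZMod n → Tape | ω u ∈ S ∧ ω v ∈ T} =
      Set.pi Set.univ (fun w => if w = u then S else if w = v then T else Set.univ) := by
    ext ω
    simp only [Set.mem_ofPred_eq, Set.mem_pi, Set.mem_univ, true_imp_iff]
    refine ⟨fun h w => ?_, fun h => ⟨by simpa using h u, by simpa [huv.symm] using h v⟩⟩
    split_ifs with h1 h2
    · rw [h1]; exact h.1
    · rw [h2]; exact h.2
    · trivial
  rw [this, ringLaw, Measure.pi_pi, Finset.prod_eq_mul u v huv]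
  · simp [huv.symm]
  · intro w _ hw; simp [hw.1, hw.2]
  · simp
  · simp

lemma ringLaw_all (S : Set Tape) : ringLaw n {ω | ∀ v, ω v ∈ S} = tapeLaw S ^ n := by
  have : {ω : ZMod n → Tape | ∀ v, ω v ∈ S} = Set.pi Set.univ (fun _ => S) := by
    ext ω; simp
  rw [this, ringLaw, Measure.pi_pi]
  simp [ZMod.card]

/-- Two nodes rarely draw the same large identifier. -/
lemma ringLaw_collision_le (K l : ℕ) {u v : ZMod n} (huv : u ≠ v) :
    ringLaw n {ω | randomId K (ω u) = randomId K (ω v) ∧ 2 ^ l ≤ randomId K (ω u)} ≤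
      (2⁻¹ : ENNReal) ^ l := by
  let P : ℕ → Set Tape := fun m => {ω | randomId K ω = m}
  have hsub : {ω : ZMod n → Tape | randomId K (ω u) = randomId K (ω v) ∧
      2 ^ l ≤ randomId K (ω u)} ⊆ ⋃ m, {ω | (ω u ∈ P m ∧ ω v ∈ P m) ∧ 2 ^ l ≤ m} := by
    rintro ω ⟨h1, h2⟩
    exact Set.mem_iUnion.2 ⟨_, ⟨rfl, h1.symm⟩, h2⟩
  calc _ ≤ ringLaw n (⋃ m, {ω | (ω u ∈ P m ∧ ω v ∈ P m) ∧ 2 ^ l ≤ m}) := measure_mono hsub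
    _ ≤ ∑' m, ringLaw n {ω | (ω u ∈ P m ∧ ω v ∈ P m) ∧ 2 ^ l ≤ m} := measure_iUnion_le _
    -- One factor is bounded uniformly; the other is kept, since the disjoint events `P m` have
    -- total mass at most `1`.
    _ ≤ ∑' m, (2⁻¹ : ENNReal) ^ l * tapeLaw (P m) := by
        refine ENNReal.tsum_le_tsum fun m => ?_
        by_cases hm : 2 ^ l ≤ m
        · simp only [hm, and_true]
          rw [ringLaw_coord_coord huv]
          gcongr
          exact tapeLaw_randomId_eq_le K hm
        · simp [hm]
    _ = (2⁻¹ : ENNReal) ^ l * tapeLaw (⋃ m, P m) := by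
        rw [ENNReal.tsum_mul_left, measure_iUnion]
        · intro a b hab
          refine Set.disjoint_left.2 fun ω ha hb => hab ?_
          exact Eq.trans (Eq.symm ha) hb
        · exact fun m => measurable_randomId K (measurableSet_singleton m)
    _ ≤ (2⁻¹ : ENNReal) ^ l := mul_le_of_le_one_right' prob_le_one

/-- Except with small probability, the largest identifier is attained once and not too large. -/
lemma ringLaw_not_unique_max_le {K : ℕ} (hK : 0 < K) (a b : ℕ) :
    ringLaw n {ω | ¬ ∃ l, (∀ v, v ≠ l → randomId K (ω v) < randomId K (ω l)) ∧
        randomId K (ω l) < 2 ^ (K * (b + 1))} ≤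
      (1 - (2⁻¹ : ENNReal) ^ a) ^ n + n ^ 2 * (2⁻¹ : ENNReal) ^ (K * (a + 1)) +
        n * (2⁻¹ : ENNReal) ^ b := by
  -- The bad events: all identifiers small, a tie between large ones, some identifier huge. Outside
  -- `E₁` the maximum is large, so ties between small identifiers are harmless.
  let E₁ : Set (ZMod n → Tape) := {ω | ∀ v, ω v ∈ {τ | randomId K τ < 2 ^ (K * (a + 1))}}
  let E₂ : ZMod n × ZMod n → Set (ZMod n → Tape) := fun x =>
    {ω | x.1 ≠ x.2 ∧ randomId K (ω x.1) = randomId K (ω x.2) ∧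
      2 ^ (K * (a + 1)) ≤ randomId K (ω x.1)}
  let E₃ : ZMod n → Set (ZMod n → Tape) := fun v =>
    {ω | ω v ∈ {τ | 2 ^ (K * (b + 1)) ≤ randomId K τ}}
  have hsub : {ω | ¬ ∃ l, (∀ v, v ≠ l → randomId K (ω v) < randomId K (ω l)) ∧
      randomId K (ω l) < 2 ^ (K * (b + 1))} ⊆ E₁ ∪ (⋃ x, E₂ x) ∪ ⋃ v, E₃ v := by
    intro ω hω
    by_contra hn
    simp only [Set.mem_union, Set.mem_iUnion, not_or, not_exists] at hn
    obtain ⟨⟨h1, h2⟩, h3⟩ := hn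
    obtain ⟨w, hw⟩ : ∃ w, 2 ^ (K * (a + 1)) ≤ randomId K (ω w) := by
      simpa [E₁] using h1
    obtain ⟨l, -, hl⟩ := Finset.exists_max_image Finset.univ (fun v => randomId K (ω v))
      ⟨w, Finset.mem_univ w⟩
    refine hω ⟨l, fun v hv => lt_of_le_of_ne (hl v (Finset.mem_univ v)) fun heq => ?_, ?_⟩
    · exact h2 (v, l) ⟨hv, heq, by rw [heq]; exact hw.trans (hl w (Finset.mem_univ w))⟩
    · exact not_le.1 (h3 l)
  refine (measure_mono hsub).trans ((measure_union_le _ _).trans (add_le_add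
    ((measure_union_le _ _).trans (add_le_add ?_ ?_)) ?_))
  · rw [ringLaw_all]
    gcongr
    exact tapeLaw_randomId_lt K a
  · refine (measure_iUnion_fintype_le _ _).trans ?_
    calc ∑ x, ringLaw n (E₂ x) ≤ ∑ x : ZMod n × ZMod n, (2⁻¹ : ENNReal) ^ (K * (a + 1)) := by
          refine Finset.sum_le_sum fun x _ => ?_
          by_cases hx : x.1 = x.2
          · simp [E₂, hx]
          · exact (measure_mono fun ω hω => hω.2).trans (ringLaw_collision_le K _ hx)
      _ = n ^ 2 * (2⁻¹ : ENNReal) ^ (K * (a + 1)) := by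
          simp [ZMod.card, sq]
  · refine (measure_iUnion_fintype_le _ _).trans ?_
    calc ∑ v, ringLaw n (E₃ v) ≤ ∑ v : ZMod n, (2⁻¹ : ENNReal) ^ b := by
          refine Finset.sum_le_sum fun v _ => ?_
          rw [ringLaw_coord]
          exact tapeLaw_le_randomId hK b
      _ = n * (2⁻¹ : ENNReal) ^ b := by simp [ZMod.card]

end Ring

/-! ### Choice of parameters -/

lemma lt_four_pow_log (n : ℕ) : (n : ℝ) < 4 ^ (Nat.log 4 n + 1) := by
  exact_mod_cast Nat.lt_pow_succ_log_self (by norm_num : 1 < 4) n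

lemma four_pow_log_le {n : ℕ} (hn : n ≠ 0) : (4 : ℝ) ^ Nat.log 4 n ≤ n := by
  exact_mod_cast Nat.pow_log_le_self 4 hn

lemma half_pow_two_mul_le (n e : ℕ) (hn : 0 < n) :
    (2⁻¹ : ℝ) ^ (2 * e * (Nat.log 4 n + 1)) ≤ ((n : ℝ) ^ e)⁻¹ := by
  have h : (2 : ℝ) ^ (2 * e * (Nat.log 4 n + 1)) = (4 ^ (Nat.log 4 n + 1)) ^ e := by
    rw [← pow_mul, show (4 : ℝ) = 2 ^ 2 by norm_num, ← pow_mul]; ring_nf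
  have hn' : (0 : ℝ) < n := by exact_mod_cast hn
  rw [inv_pow, h]
  gcongr
  exact (lt_four_pow_log n).le

/-- With `a = Nat.log 4 n`, `2 ^ a` is of order `√n`, so `n * 2 ^ (-a) ≥ 2 ^ a` and the left side is
at most `exp (-2 ^ a)`. The term of degree `2 * d` of the exponential series beats `n ^ d`; `4 ^ d`
pays for rounding the logarithm. -/
lemma one_sub_half_pow_log_pow_le (n d : ℕ) (hn : 0 < n) :
    (1 - (2⁻¹ : ℝ) ^ Nat.log 4 n) ^ n ≤ (2 * d).factorial * 4 ^ d * ((n : ℝ) ^ d)⁻¹ := by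
  set a := Nat.log 4 n with ha
  have hn' : (0 : ℝ) < n := by exact_mod_cast hn
  have h4 : (4 : ℝ) ^ a = 2 ^ a * 2 ^ a := by rw [← mul_pow]; norm_num
  have h1 : (2 : ℝ) ^ a ≤ n * (2⁻¹ : ℝ) ^ a := by
    rw [inv_pow, ← div_eq_mul_inv, le_div_iff₀ (by positivity), ← h4]
    exact four_pow_log_le hn.ne'
  have h2 : (1 - (2⁻¹ : ℝ) ^ a) ^ n ≤ Real.exp (-(2 ^ a)) := by
    calc (1 - (2⁻¹ : ℝ) ^ a) ^ n ≤ Real.exp (-(2⁻¹ : ℝ) ^ a) ^ n := by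
          gcongr
          · exact sub_nonneg.2 (pow_le_one₀ (by norm_num) (by norm_num))
          · exact Real.one_sub_le_exp_neg _
      _ = Real.exp (-(n * (2⁻¹ : ℝ) ^ a)) := by rw [← Real.exp_nat_mul]; ring_nf
      _ ≤ Real.exp (-(2 ^ a)) := by gcongr
  have h3 := Real.pow_div_factorial_le_exp (x := 2 ^ a) (by positivity) (2 * d)
  have h5 : (n : ℝ) ^ d ≤ 4 ^ d * ((2 : ℝ) ^ a) ^ (2 * d) := by
    rw [pow_mul, sq, ← h4, ← mul_pow, ← pow_succ']
    gcongr
    exact (lt_four_pow_log n).le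
  refine h2.trans ?_
  rw [Real.exp_neg, ← div_eq_mul_inv, inv_le_comm₀ (by positivity) (by positivity), inv_div]
  refine le_trans ?_ h3
  rw [div_le_div_iff₀ (by positivity) (by positivity)]
  calc (n : ℝ) ^ d * (2 * d).factorial ≤ (4 ^ d * ((2 : ℝ) ^ a) ^ (2 * d)) * (2 * d).factorial := by
        gcongr
    _ = _ := by ring

lemma half_pow_eq_ofReal (e : ℕ) : (2⁻¹ : ENNReal) ^ e = ENNReal.ofReal ((2⁻¹ : ℝ) ^ e) := by
  rw [ENNReal.ofReal_pow (by norm_num), ENNReal.ofReal_inv_of_pos (by norm_num)]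
  simp

/-- The exponent `d + 2` pays for the `n ^ 2` pairs of nodes, `d + 1` for the union over `n` nodes.
-/
lemma failure_bound (n d : ℕ) (hn : 0 < n) :
    (1 - (2⁻¹ : ENNReal) ^ Nat.log 4 n) ^ n +
      n ^ 2 * (2⁻¹ : ENNReal) ^ (2 * (d + 2) * (Nat.log 4 n + 1)) +
        n * (2⁻¹ : ENNReal) ^ (2 * (d + 1) * (Nat.log 4 n + 1)) ≤
      ENNReal.ofReal (((2 * d).factorial * 4 ^ d + 2) * ((n : ℝ) ^ d)⁻¹) := by
  have hn' : (0 : ℝ) < n := by exact_mod_cast hn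
  have hnn : (n : ENNReal) = ENNReal.ofReal n := (ENNReal.ofReal_natCast n).symm
  have hle : (2⁻¹ : ℝ) ^ Nat.log 4 n ≤ 1 := pow_le_one₀ (by norm_num) (by norm_num)
  have h0 : (0 : ℝ) ≤ 1 - (2⁻¹ : ℝ) ^ Nat.log 4 n := sub_nonneg.2 hle
  rw [half_pow_eq_ofReal, half_pow_eq_ofReal, half_pow_eq_ofReal, hnn, ← ENNReal.ofReal_one,
    ← ENNReal.ofReal_sub _ (by positivity), ← ENNReal.ofReal_pow h0,
    ← ENNReal.ofReal_pow hn'.le, ← ENNReal.ofReal_mul (by positivity),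
    ← ENNReal.ofReal_mul (by positivity), ← ENNReal.ofReal_add (by positivity) (by positivity),
    ← ENNReal.ofReal_add (by positivity) (by positivity)]
  refine ENNReal.ofReal_le_ofReal ?_
  have h1 := one_sub_half_pow_log_pow_le n d hn
  have h2 : (n : ℝ) ^ 2 * (2⁻¹ : ℝ) ^ (2 * (d + 2) * (Nat.log 4 n + 1)) ≤ ((n : ℝ) ^ d)⁻¹ := by
    calc _ ≤ (n : ℝ) ^ 2 * ((n : ℝ) ^ (d + 2))⁻¹ := by
          gcongr; exact half_pow_two_mul_le n (d + 2) hn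
      _ = _ := by rw [pow_add]; field_simp
  have h3 : (n : ℝ) * (2⁻¹ : ℝ) ^ (2 * (d + 1) * (Nat.log 4 n + 1)) ≤ ((n : ℝ) ^ d)⁻¹ := by
    calc _ ≤ (n : ℝ) * ((n : ℝ) ^ (d + 1))⁻¹ := by
          gcongr; exact half_pow_two_mul_le n (d + 1) hn
      _ = _ := by rw [pow_add]; field_simp
  linarith

lemma two_pow_le_polynomial (n K e : ℕ) (hn : 0 < n) :
    (2 : ℝ) ^ (K * (2 * e * (Nat.log 4 n + 1) + 1)) ≤ 2 ^ K * 4 ^ (e * K) * (n : ℝ) ^ (e * K) := by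
  have h : (2 : ℝ) ^ (K * (2 * e * (Nat.log 4 n + 1) + 1)) =
      2 ^ K * 4 ^ (e * K) * (4 ^ Nat.log 4 n) ^ (e * K) := by
    rw [← pow_mul, show (4 : ℝ) = 2 ^ 2 by norm_num, ← pow_mul, ← pow_mul, ← pow_add, ← pow_add]
    ring_nf
  rw [h]
  gcongr
  exact four_pow_log_le hn.ne'

end

end ContentOblivious

open ContentOblivious

/-! ### The main theorem -/

theorem mainTheorem5 (c : ℝ) (hc : 0 < c) :
    ∃ (A : ContentOblivious.Algorithm) (C : ℝ) (k : ℕ),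
      ∀ (n : ℕ) [NeZero n] (o : ZMod n → ContentOblivious.Port),
        -- with high probability, success with polynomially many pulses under every schedule
        ContentOblivious.ringLaw n
            {ω | ¬ ∀ e, A.IsExecution o ω e → A.Succeeds o ω e (C * (n : ℝ) ^ k)}
          ≤ ENNReal.ofReal (C * (n : ℝ) ^ (-c)) ∧
        -- quiescence is reached almost surely, under every schedule
        (∀ᵐ ω ∂(ContentOblivious.ringLaw n), ∀ e, A.IsExecution o ω e → ∃ t, (e t).Quiescent) ∧
        -- no node ever terminates
        (∀ ω e, A.IsExecution o ω e → ∀ t v, (A.current ω (e t) v).terminated = false) := by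
  obtain ⟨d, hd⟩ := exists_nat_ge c
  -- Makes `2 ^ (K * (Nat.log 4 n + 1))` exceed `n ^ (d + 2)`.
  let K := 2 * (d + 2)
  have hK : 0 < K := by positivity
  let C₁ : ℝ := (2 * d).factorial * 4 ^ d + 2
  -- The factor `6` comes from `2 * (2 * i + 1) ≤ 6 * i` for `i ≥ 1`.
  let C₂ : ℝ := 6 * (2 ^ K * 4 ^ ((d + 1) * K))
  have hC₁ : 0 ≤ C₁ := by positivity
  have hC₂ : 0 ≤ C₂ := by positivity
  refine ⟨randomCounting K hK, C₁ + C₂, (d + 1) * K + 1, fun n _ o => ⟨?_, ?_, ?_⟩⟩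
  · have hn : 0 < n := NeZero.pos n
    have hn1 : (1 : ℝ) ≤ n := by exact_mod_cast hn
    have hsub : {ω | ¬ ∀ e, (randomCounting K hK).IsExecution o ω e →
        (randomCounting K hK).Succeeds o ω e ((C₁ + C₂) * (n : ℝ) ^ ((d + 1) * K + 1))} ⊆
        {ω | ¬ ∃ l, (∀ v, v ≠ l → randomId K (ω v) < randomId K (ω l)) ∧
          randomId K (ω l) < 2 ^ (K * (2 * (d + 1) * (Nat.log 4 n + 1) + 1))} := by
      rintro ω hω ⟨l, hl, hlt⟩
      refine hω fun e he => succeeds_of_unique_max (i := fun v => randomId K (ω v))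
        (fun _ _ => rfl) (fun _ => randomId_pos K _) he hl ?_
      have h1 : ((randomId K (ω l) : ℕ) : ℝ) ≤ 2 ^ K * 4 ^ ((d + 1) * K) * (n : ℝ) ^ ((d + 1) * K) :=
        le_trans (by exact_mod_cast hlt.le) (two_pow_le_polynomial n K (d + 1) hn)
      have h2 : (1 : ℝ) ≤ randomId K (ω l) := by exact_mod_cast randomId_pos K (ω l)
      push_cast
      calc (n : ℝ) * (2 * (2 * randomId K (ω l) + 1)) ≤ n * (6 * randomId K (ω l)) :=
            mul_le_mul_of_nonneg_left (by linarith) (by positivity)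
        _ ≤ n * (6 * (2 ^ K * 4 ^ ((d + 1) * K) * (n : ℝ) ^ ((d + 1) * K))) := by gcongr
        _ = C₂ * (n : ℝ) ^ ((d + 1) * K + 1) := by simp only [C₂]; ring
        _ ≤ (C₁ + C₂) * (n : ℝ) ^ ((d + 1) * K + 1) := by gcongr; linarith
    refine (measure_mono hsub).trans ((ringLaw_not_unique_max_le hK _ _).trans
      ((failure_bound n d hn).trans (ENNReal.ofReal_le_ofReal ?_)))
    have h3 : ((n : ℝ) ^ d)⁻¹ ≤ (n : ℝ) ^ (-c) := by
      rw [← Real.rpow_natCast, ← Real.rpow_neg (by positivity)]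
      exact Real.rpow_le_rpow_of_exponent_le hn1 (neg_le_neg hd)
    calc C₁ * ((n : ℝ) ^ d)⁻¹ ≤ C₁ * (n : ℝ) ^ (-c) := by gcongr
      _ ≤ (C₁ + C₂) * (n : ℝ) ^ (-c) := by gcongr; linarith
  · exact Filter.Eventually.of_forall fun ω e he =>
      exists_quiescent (i := fun v => randomId K (ω v)) (fun _ _ => rfl)
        (fun _ => randomId_pos K _) he
  · exact fun _ _ _ _ _ => rfl
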